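/- **Setting.** Let $m\ge 1$ and let $\Omega\subset\mathbb R^3$ be a bounded domain with $\overline\Omega$ convex and $\partial\Omega\in C^{1,\alpha}$, $0<\alpha\le1$, with exterior unit normal $n=(n_1,n_2,n_3)$ and surface measure $dS$. For $u=(u_1,\dots,u_m)^T$ let $v_1,\dots,v_{10m}$ be a permutation of the components of $u$, $u_x,u_y,u_z$, $u_{xx},u_{xy},u_{xz},u_{yy},u_{yz},u_{zz}$, and consider the Dirichlet problem $$v_j=f_j(v_{m+1},\dots,v_{10m},x,y,z),\quad 1\le j\le m,\qquad u|_{\partial\Omega}=A_1,$$ with $f_j$ continuous on $\mathbb R^{9m}\times\overline\Omega$ and $A_1$ the restriction to $\partial\Omega$ of a $C^2$ function on $\mathbb R^3$ (also denoted $A_1$). Put $Z_1=(v_{m+1},\dots,v_{10m})^T$. For real constants $c_{jk}$ let $\psi(Z_1)=\big(f_j(Z_1,X)-\sum_{k=1}^{9m}c_{jk}Z_{1,k}\big)_{1\le j\le m}$, $X=(x,y,z)^T$, and let $\psi_1(Z_1)$ be $-\Delta u$ written as a function of $Z_1$ (each of $u_{xx},u_{yy},u_{zz}$ being, componentwise,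 either a component of $Z_1$ or some $f_j$). *The matrices.* Let $A_0,A_{01},A_{02},A_{03},A_{11},A_{12},A_{13},A_{22},A_{23},A_{33}$ be the $m\times 10m$ matrices expressing $u,u_x,u_y,u_z,u_{xx},u_{xy},u_{xz},u_{yy},u_{yz},u_{zz}$ through $Z=(Z_1^T,S^T)^T$ by means of $v_j=\sum_k c_{jk}v_{m+k}+s_j$ for $j\le m$ (where $S=(s_1,\dots,s_m)^T$). Let $B=(B_1,-B_2)$, with $B_1$ of size $9m\times9m$ and $B_2$ of size $9m\times m$, be the matrix with block rows $i\xi_jA_0-A_{0j}$ ($1\le j\le3$) and $i\xi_ji\xi_lA_0-A_{jl}$ ($1\le j\le l\le3$). The $c_{jk}$ are such that $\det B_1\not\equiv0$ and, for some nonzero polynomial $a_1$ in $i\xi_1,i\xi_2,i\xi_3$ for which $a_1B_1^{-1}$ is a polynomial matrix, the entries of $(1+|\xi|^2)^{-a-3}B_1^{-1}$ and $(1+|\xi|^2)^{-a-3}B_1^{-1}B_2$ are in $L^1(\mathbb R^3)$, where $a$ is the highest degree of the entries of $a_1B_1^{-1}$ and $a_1B_1^{-1}B_2$. *The boundary terms.*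 Let $h(X)=\frac1{4\pi|X|}$. For $Z_1\in C(\overline\Omega)$ let $A_5$ be the continuous solution on $\partial\Omega$ of $$\tfrac12A_5(P_0)=\int_{\partial\Omega}[\nabla h(P_0-P)\cdot n_{P_0}]A_5(P)\,dS_P+g_{02}(P_0)+\int_\Omega[\nabla h(P_0-Y)\cdot n_{P_0}]\,\psi_1(Z_1)(Y)\,dY,$$ where $g_{02}(P_0)$ is the limit, along the normal at $P_0$ from the interior, of the derivative in the direction $n_{P_0}$ of $g_{01}(M)=\int_{\partial\Omega}[\nabla h(M-P)\cdot n_P]A_1(P)\,dS_P$. Let $A_{j+1}=\partial_jA_1+(A_5-\partial A_1/\partial n)n_j$, $1\le j\le3$ (the boundary values of $u_x,u_y,u_z$), $g_j(\xi)=\int_{\partial\Omega}A_1n_je^{-i\xi\cdot P}dS_P$, $g_{jl}(\xi)=\int_{\partial\Omega}A_{j+1}n_le^{-i\xi\cdot P}dS_P$, and let $\beta_1(\xi)$ be the column of length $9m$ with blocks $-g_1,-g_2,-g_3$, $-g_{11}-i\xi_1g_1$, $-g_{21}-i\xi_1g_2$, $-g_{31}-i\xi_1g_3$, $-g_{22}-i\xi_2g_2$,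 $-g_{32}-i\xi_2g_3$, $-g_{33}-i\xi_3g_3$. *The mollified operator.* With $F(\varphi)(\xi)=\int\varphi(X)e^{-i\xi\cdot X}dX$ and $\delta_\epsilon(X)=(\sqrt{\pi\epsilon})^{-3}e^{-|X|^2/\epsilon}$, $\epsilon>0$, put $$T_{0\epsilon}(Z_1)(X)=F^{-1}\big(F(\delta_\epsilon)B_1^{-1}\beta_1\big)(X)+\int_{\overline\Omega}F^{-1}\big(F(\delta_\epsilon)B_1^{-1}B_2\big)(X-Y)\,\psi(Z_1)(Y)\,dY,\qquad X\in\overline\Omega .$$ Let $\|Z_1\|_\infty=\max_{1\le i\le9m}\max_{\overline\Omega}|Z_{1,i}|$, $\|Z_1\|_{L^2}=\max_{1\le i\le9m}\|Z_{1,i}\|_{L^2(\Omega)}$, and for $M>0$ let $\Omega_M=\{Z_1\in C(\overline\Omega):\|Z_1\|_\infty<M\}$. **Theorem 4.3.** For every $M>0$ the following are equivalent. 1. There exist $\epsilon_k>0$ and $Z_{1\epsilon_k}\in\Omega_M$ with $Z_{1\epsilon_k}=T_{0\epsilon_k}(Z_{1\epsilon_k})$ on $\overline\Omega$, $k\ge1$,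 such that $\lim_{k\to\infty}\epsilon_k=0$ and $\lim_{k\to\infty}Z_{1\epsilon_k}$ exists almost everywhere on $\overline\Omega$. 2. There exist $\eta_k>0$ and $Z_{1\eta_k}\in\Omega_M$ with $Z_{1\eta_k}=T_{0\eta_k}(Z_{1\eta_k})$ on $\overline\Omega$, $k\ge1$, such that $\lim_{k\to\infty}\eta_k=0$ and $\lim_{k,l\to\infty}\|Z_{1\eta_k}-Z_{1\eta_l}\|_{L^2}=0$. -/

import Mathlib

open MeasureTheory Filter Topology

noncomputable section

namespace DirichletResolved

/-- Euclidean space `ℝ³`; the coordinates `x, y, z` are numbered `0, 1, 2`. -/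
abbrev E3 : Type := EuclideanSpace ℝ (Fin 3)

/-- The index set of the `9m` components of `Z₁`; the pair `(l, k)` is the `k`-th entry of the
`l`-th block of length `m`. -/
abbrev Idx (m : ℕ) : Type := Fin 9 × Fin m

/-! ### Geometry of the domain -/

/-- The point of `ℝ²` obtained from `P` by dropping the coordinate number `j`. -/
def dropCoord (j : Fin 3) (P : E3) : EuclideanSpace ℝ (Fin 2) :=
  WithLp.toLp 2 (fun i => P (j.succAbove i))

/-- `∂Ω ∈ C^{1,α}`: near each boundary point, `∂Ω` is the graph of a `C^{1,α}` function `φ` of two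
of the three coordinates, `Ω` lies on one side of the graph and the exterior on the other. -/
def HasC1AlphaBoundary (Ω : Set E3) (α : ℝ) : Prop :=
  ∀ P₀ ∈ frontier Ω, ∃ δ : ℝ, 0 < δ ∧ ∃ (j : Fin 3) (s : ℝ) (φ : EuclideanSpace ℝ (Fin 2) → ℝ),
    (s = 1 ∨ s = -1) ∧
    ContDiffOn ℝ 1 φ (Metric.ball (dropCoord j P₀) δ) ∧
    (∃ C : ℝ, ∀ p ∈ Metric.ball (dropCoord j P₀) δ, ∀ q ∈ Metric.ball (dropCoord j P₀) δ,
      ‖fderiv ℝ φ p - fderiv ℝ φ q‖ ≤ C * dist p q ^ α) ∧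
    ∀ P ∈ Metric.ball P₀ δ,
      (P ∈ frontier Ω ↔ s * (P j - φ (dropCoord j P)) = 0) ∧
      (P ∉ closure Ω ↔ 0 < s * (P j - φ (dropCoord j P))) ∧
      (P ∈ Ω ↔ s * (P j - φ (dropCoord j P)) < 0)

/-- `ν` is the exterior unit normal of `Ω` at `P`: seen from `P`, the set `Ω` agrees to first order
with the half-space `⟪ν, X - P⟫ < 0`. There is at most one such `ν`. -/
def IsExteriorUnitNormal (Ω : Set E3) (P ν : E3) : Prop :=
  ‖ν‖ = 1 ∧ ∀ τ : ℝ, 0 < τ → ∃ δ : ℝ, 0 < δ ∧ ∀ X ∈ Metric.ball P δ,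
    (τ * ‖X - P‖ < inner ℝ ν (X - P) → X ∉ closure Ω) ∧
    (inner ℝ ν (X - P) < -(τ * ‖X - P‖) → X ∈ Ω)

open Classical in
/-- The exterior unit normal field `n` of `∂Ω`. -/
def exteriorNormal (Ω : Set E3) (P : E3) : E3 :=
  if h : ∃ ν, IsExteriorUnitNormal Ω P ν then h.choose else 0

/-- Surface measure `dS` on `∂Ω`: two-dimensional Hausdorff measure, normalized so that it agrees
with area on planes. -/
def surfaceMeasure (Ω : Set E3) : Measure E3 :=
  (μHE[2] : Measure E3).restrict (frontier Ω)

/-! ### Fourier transform, Gaussian mollifier, Newton kernel -/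

/-- `F(φ)(ξ) = ∫ φ(X) e^{-i ξ·X} dX`. -/
def fourier (φ : E3 → ℂ) (ξ : E3) : ℂ :=
  ∫ X, φ X * Complex.exp (-(Complex.I * ((inner ℝ ξ X : ℝ) : ℂ)))

/-- `F⁻¹(φ)(X) = (2π)⁻³ ∫ φ(ξ) e^{i ξ·X} dξ`. -/
def invFourier (φ : E3 → ℂ) (X : E3) : ℂ :=
  ((2 * Real.pi : ℝ) : ℂ)⁻¹ ^ 3 *
    ∫ ξ, φ ξ * Complex.exp (Complex.I * ((inner ℝ ξ X : ℝ) : ℂ))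

/-- The mollifier `δ_ε(X) = (√(πε))⁻³ e^{-|X|²/ε}`. -/
def gaussMollifier (ε : ℝ) (X : E3) : ℝ :=
  (Real.sqrt (Real.pi * ε))⁻¹ ^ 3 * Real.exp (-(‖X‖ ^ 2 / ε))

/-- `F(δ_ε)`. -/
def mollifierSymbol (ε : ℝ) (ξ : E3) : ℂ :=
  fourier (fun X => (gaussMollifier ε X : ℂ)) ξ

/-- The kernel `h(X) = 1 / (4π|X|)`. -/
def newtonKernel (X : E3) : ℝ := 1 / (4 * Real.pi * ‖X‖)

/-- The surface Fourier integral `∫_{∂Ω} φ e^{-i ξ·P} dS_P`. -/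
def surfaceFourier (Ω : Set E3) (φ : E3 → ℝ) (ξ : E3) : ℂ :=
  ∫ P, (φ P : ℂ) * Complex.exp (-(Complex.I * ((inner ℝ ξ P : ℝ) : ℂ))) ∂(surfaceMeasure Ω)

/-! ### The Dirichlet problem -/

/-- The data of the Dirichlet problem for `m` unknown functions on `Ω`, resolved with respect to
`m` of the `10m` quantities `u, ∂u, ∂²u`, together with the constants `c_{jk}`.

The quantity `(d, k) : Fin 10 × Fin m` is the `k`-th component of the `d`-th vector in the list
`u, u_x, u_y, u_z, u_xx, u_xy, u_xz, u_yy, u_yz, u_zz`. -/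
structure Problem (m : ℕ) where
  /-- the domain -/
  Ω : Set E3
  /-- the arrangement of the `10m` quantities as `v_1, …, v_{10m}`: those sent to `Sum.inl j` are
  the resolved ones `v_j`, `j ≤ m`; those sent to `Sum.inr` are the components of `Z₁` -/
  σ : Fin 10 × Fin m ≃ Fin m ⊕ Idx m
  /-- the right-hand sides: `v_j = f_j(v_{m+1}, …, v_{10m}, x, y, z)` -/
  f : (Idx m → ℝ) → E3 → Fin m → ℝ
  /-- the Dirichlet datum `A₁ = u|_{∂Ω}`, given through an extension to `ℝ³` -/
  A₁ : Fin m → E3 → ℝ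
  /-- the constants `c_{jk}` -/
  c : Matrix (Fin m) (Idx m) ℝ

namespace Problem

variable {m : ℕ} (D : Problem m)

/-! #### Symbols. Polynomials in `iξ₁, iξ₂, iξ₃` are polynomials in three variables, evaluated at
`iξ`. -/

/-- Evaluation of a polynomial at `(iξ₁, iξ₂, iξ₃)`. -/
def evalSymbol (ξ : E3) : MvPolynomial (Fin 3) ℂ →+* ℂ :=
  MvPolynomial.eval (fun j => Complex.I * (ξ j : ℂ))

/-- The symbols of `∂_x, ∂_y, ∂_z, ∂_x², ∂_x∂_y, ∂_x∂_z, ∂_y², ∂_y∂_z, ∂_z²`. -/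
def derivSymbol : Fin 9 → MvPolynomial (Fin 3) ℂ :=
  ![MvPolynomial.X 0, MvPolynomial.X 1, MvPolynomial.X 2,
    MvPolynomial.X 0 ^ 2, MvPolynomial.X 0 * MvPolynomial.X 1,
    MvPolynomial.X 0 * MvPolynomial.X 2, MvPolynomial.X 1 ^ 2,
    MvPolynomial.X 1 * MvPolynomial.X 2, MvPolynomial.X 2 ^ 2]

/-- The matrices `A₀, A₀₁, …, A₃₃`: row `(d, k)` expresses the quantity `(d, k)` through
`Z = (Z₁, S)`. A component of `Z₁` is itself, and a resolved quantity is
`v_j = ∑ c_{jk} v_{m+k} + s_j`. -/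
def rowOf (p : Fin 10 × Fin m) : Idx m ⊕ Fin m → ℝ :=
  match D.σ p with
  | Sum.inl j => Sum.elim (D.c j) (Pi.single j 1)
  | Sum.inr i => Sum.elim (Pi.single i 1) 0

/-- The `9m × 10m` matrix `B`, whose rows are `(symbol of the d-th derivative) A₀ - A_d`. -/
def B : Matrix (Idx m) (Idx m ⊕ Fin m) (MvPolynomial (Fin 3) ℂ) := fun p q =>
  derivSymbol p.1 * MvPolynomial.C ((D.rowOf (0, p.2) q : ℝ) : ℂ)
    - MvPolynomial.C ((D.rowOf (p.1.succ, p.2) q : ℝ) : ℂ)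

/-- `B₁`: the first `9m` columns of `B`. -/
def B₁ : Matrix (Idx m) (Idx m) (MvPolynomial (Fin 3) ℂ) := fun p i => D.B p (Sum.inl i)

/-- `B₂`: minus the last `m` columns of `B`. -/
def B₂ : Matrix (Idx m) (Fin m) (MvPolynomial (Fin 3) ℂ) := fun p j => -D.B p (Sum.inr j)

/-- The matrix `B₁⁻¹` at `ξ`; it is a genuine inverse off the null set `det B₁ = 0`. -/
def B₁inv (ξ : E3) : Matrix (Idx m) (Idx m) ℂ := (D.B₁.map (evalSymbol ξ))⁻¹

/-- The matrix `B₁⁻¹ B₂` at `ξ`. -/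
def B₁invB₂ (ξ : E3) : Matrix (Idx m) (Fin m) ℂ := D.B₁inv ξ * D.B₂.map (evalSymbol ξ)

/-- The requirements on the constants `c_{jk}`: `det B₁ ≠ 0`, and for some nonzero polynomial `a₁`
such that `a₁ B₁⁻¹` is a polynomial matrix `N`, the functions `(1 + |ξ|²)^{-a-3} B₁⁻¹` and
`(1 + |ξ|²)^{-a-3} B₁⁻¹ B₂` are integrable on `ℝ³`, `a` being the highest degree of an entry of
`a₁ B₁⁻¹` or `a₁ B₁⁻¹ B₂`. -/
def AdmissibleConstants : Prop :=
  D.B₁.det ≠ 0 ∧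
  ∃ (a₁ : MvPolynomial (Fin 3) ℂ) (N : Matrix (Idx m) (Idx m) (MvPolynomial (Fin 3) ℂ)) (a : ℕ),
    a₁ ≠ 0 ∧ D.B₁ * N = a₁ • (1 : Matrix (Idx m) (Idx m) (MvPolynomial (Fin 3) ℂ)) ∧
    a = max (Finset.univ.sup fun p : Idx m × Idx m => (N p.1 p.2).totalDegree)
      (Finset.univ.sup fun p : Idx m × Fin m => ((N * D.B₂) p.1 p.2).totalDegree) ∧
    (∀ i j, Integrable (fun ξ : E3 => (((1 + ‖ξ‖ ^ 2) ^ (a + 3))⁻¹ : ℝ) • D.B₁inv ξ i j)) ∧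
    (∀ i j, Integrable (fun ξ : E3 => (((1 + ‖ξ‖ ^ 2) ^ (a + 3))⁻¹ : ℝ) • D.B₁invB₂ ξ i j))

/-! #### The nonlinearities -/

/-- `ψ(Z₁) = Z₂`, that is `s_j = f_j(Z₁, X) - ∑ c_{jk} Z_{1,k}`. -/
def psi (Z : E3 → Idx m → ℝ) (X : E3) (j : Fin m) : ℝ :=
  D.f (Z X) X j - ∑ i, D.c j i * Z X i

/-- The value of the quantity `p` (a component of `u`, `∂u` or `∂²u`) as a function of `Z₁`. -/
def quantity (Z : E3 → Idx m → ℝ) (X : E3) (p : Fin 10 × Fin m) : ℝ :=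
  match D.σ p with
  | Sum.inl j => D.f (Z X) X j
  | Sum.inr i => Z X i

/-- `ψ₁(Z₁) = -(u_xx + u_yy + u_zz)` expressed through `Z₁`. -/
def psi₁ (Z : E3 → Idx m → ℝ) (X : E3) (k : Fin m) : ℝ :=
  -(D.quantity Z X (4, k) + D.quantity Z X (7, k) + D.quantity Z X (9, k))

/-! #### Boundary values -/

/-- The exterior unit normal `n` of the domain. -/
def n (P : E3) : E3 := exteriorNormal D.Ω P

/-- The double layer potential `g₀₁(M) = ∫_{∂Ω} [∇h(M - P) · n_P] A₁(P) dS_P`. -/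
def g₀₁ (k : Fin m) (M : E3) : ℝ :=
  ∫ P, fderiv ℝ newtonKernel (M - P) (D.n P) * D.A₁ k P ∂(surfaceMeasure D.Ω)

/-- `A₅` is the normal derivative `∂u/∂n` on `∂Ω` that belongs to `Z₁`: the continuous solution on
`∂Ω` of the Fredholm equation of the second kind
`A₅(P₀)/2 = ∫_{∂Ω} [∇h(P₀ - P) · n_{P₀}] A₅(P) dS_P + g₀₂(P₀) + ∫_Ω [∇h(P₀ - Y) · n_{P₀}] ψ₁(Z₁)(Y) dY`,
where `g₀₂(P₀)` is the limit of the derivative of `g₀₁` in the direction `n_{P₀}`, taken at `P₀`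
along the normal from the interior. -/
def IsNormalDerivative (Z : E3 → Idx m → ℝ) (A₅ : Fin m → E3 → ℝ) : Prop :=
  (∀ k, ContinuousOn (A₅ k) (frontier D.Ω)) ∧
  ∃ g₀₂ : Fin m → E3 → ℝ, ∀ k, ∀ P₀ ∈ frontier D.Ω,
    Tendsto (fun t : ℝ => fderiv ℝ (D.g₀₁ k) (P₀ - t • D.n P₀) (D.n P₀)) (𝓝[>] 0)
      (𝓝 (g₀₂ k P₀)) ∧
    A₅ k P₀ / 2 =
      (∫ P, fderiv ℝ newtonKernel (P₀ - P) (D.n P₀) * A₅ k P ∂(surfaceMeasure D.Ω))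
      + g₀₂ k P₀
      + ∫ Y in closure D.Ω, fderiv ℝ newtonKernel (P₀ - Y) (D.n P₀) * D.psi₁ Z Y k

/-- `A₂, A₃, A₄`, the boundary values of `u_x, u_y, u_z` (for `j = 0, 1, 2`), obtained from `A₁`
and `A₅`: `∂_j A₁ + (A₅ - ∂A₁/∂n) n_j`. -/
def gradTrace (A₅ : Fin m → E3 → ℝ) (j : Fin 3) (k : Fin m) (P : E3) : ℝ :=
  fderiv ℝ (D.A₁ k) P (EuclideanSpace.single j 1)
    + (A₅ k P - fderiv ℝ (D.A₁ k) P (D.n P)) * D.n P j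

/-- `g_j = ∫_{∂Ω} A₁ n_j e^{-iξ·P} dS`. -/
def g (j : Fin 3) (k : Fin m) (ξ : E3) : ℂ :=
  surfaceFourier D.Ω (fun P => D.A₁ k P * D.n P j) ξ

/-- `g_{jl} = ∫_{∂Ω} A_{j+1} n_l e^{-iξ·P} dS` (indices `j, l` counted from `1` on the left-hand
side and from `0` in the code). -/
def gg (A₅ : Fin m → E3 → ℝ) (j l : Fin 3) (k : Fin m) (ξ : E3) : ℂ :=
  surfaceFourier D.Ω (fun P => D.gradTrace A₅ j k P * D.n P l) ξ

/-- The vector `β₁` of boundary terms. -/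
def beta₁ (A₅ : Fin m → E3 → ℝ) (ξ : E3) (p : Idx m) : ℂ :=
  let k := p.2
  let iξ : Fin 3 → ℂ := fun j => Complex.I * (ξ j : ℂ)
  (![-D.g 0 k ξ, -D.g 1 k ξ, -D.g 2 k ξ,
    -D.gg A₅ 0 0 k ξ - iξ 0 * D.g 0 k ξ,
    -D.gg A₅ 1 0 k ξ - iξ 0 * D.g 1 k ξ,
    -D.gg A₅ 2 0 k ξ - iξ 0 * D.g 2 k ξ,
    -D.gg A₅ 1 1 k ξ - iξ 1 * D.g 1 k ξ,
    -D.gg A₅ 2 1 k ξ - iξ 1 * D.g 2 k ξ,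
    -D.gg A₅ 2 2 k ξ - iξ 2 * D.g 2 k ξ] : Fin 9 → ℂ) p.1

/-! #### The mollified integral equation -/

/-- `w_{1ε} = F⁻¹(F(δ_ε) B₁⁻¹ β₁)`. -/
def w₁ (ε : ℝ) (A₅ : Fin m → E3 → ℝ) (X : E3) (i : Idx m) : ℂ :=
  invFourier (fun ξ => mollifierSymbol ε ξ * (D.B₁inv ξ).mulVec (D.beta₁ A₅ ξ) i) X

/-- `w_{2ε} = F⁻¹(F(δ_ε) B₁⁻¹ B₂)`. -/
def w₂ (ε : ℝ) (X : E3) (i : Idx m) (j : Fin m) : ℂ :=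
  invFourier (fun ξ => mollifierSymbol ε ξ * D.B₁invB₂ ξ i j) X

/-- `T_{0ε}(Z₁) = w_{1ε} + w_{2ε} * (ψ(Z₁) I_{Ω̄})`, where `A₅` is the normal derivative that
belongs to `Z₁`. -/
def T₀ (ε : ℝ) (A₅ : Fin m → E3 → ℝ) (Z : E3 → Idx m → ℝ) (X : E3) (i : Idx m) : ℂ :=
  D.w₁ ε A₅ X i + ∫ Y in closure D.Ω, ∑ j, D.w₂ ε (X - Y) i j * (D.psi Z Y j : ℂ)

/-- `Z₁ = T_{0ε}(Z₁)` on `Ω̄`. -/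
def IsMollifiedSolution (ε : ℝ) (Z : E3 → Idx m → ℝ) : Prop :=
  ∃ A₅ : Fin m → E3 → ℝ, D.IsNormalDerivative Z A₅ ∧
    ∀ X ∈ closure D.Ω, ∀ i, (Z X i : ℂ) = D.T₀ ε A₅ Z X i

/-- `‖Z₁‖_∞ = max_i max_{X ∈ Ω̄} |Z_{1,i}(X)|` (the norm on `Idx m → ℝ` is the maximum norm). -/
def supNorm (Z : E3 → Idx m → ℝ) : ℝ := ⨆ X : closure D.Ω, ‖Z X‖

/-- `Ω_M = {Z₁ ∈ C(Ω̄) : ‖Z₁‖_∞ < M}`. -/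
def ball (M : ℝ) : Set (E3 → Idx m → ℝ) :=
  {Z | ContinuousOn Z (closure D.Ω) ∧ D.supNorm Z < M}

/-- `‖Z - W‖_{L²} = max_i ‖Z_i - W_i‖_{L²(Ω̄)}`. -/
def l2Dist (Z W : E3 → Idx m → ℝ) : ENNReal :=
  ⨆ i, eLpNorm (fun X => Z X i - W X i) 2 (volume.restrict (closure D.Ω))

/-- The standing assumptions: `Ω` is a bounded domain with convex closure and `C^{1,α}` boundary,
the `f_j` are continuous, the Dirichlet datum is `C²`, and the constants are admissible. -/
structure Standing (α : ℝ) : Prop where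
  isOpen : IsOpen D.Ω
  isConnected : IsConnected D.Ω
  isBounded : Bornology.IsBounded D.Ω
  convex_closure : Convex ℝ (closure D.Ω)
  boundary : HasC1AlphaBoundary D.Ω α
  continuous_f : ContinuousOn (fun p : (Idx m → ℝ) × E3 => D.f p.1 p.2)
    (Set.univ ×ˢ closure D.Ω)
  contDiff_A₁ : ∀ k, ContDiff ℝ 2 (D.A₁ k)
  admissible : D.AdmissibleConstants

end Problem

end DirichletResolved

end

open scoped ENNReal NNReal

/-! The two statements differ only in the mode of convergence: the fixed-point equation constrains
each term separately, so it is carried along unchanged and survives passage to a subsequence. From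
almost everywhere to `L²`: the closure of a bounded set has finite measure and every term is bounded
by `M`, so no mass can concentrate; uniform integrability and Vitali's theorem give convergence in
`L²` to the pointwise limit, hence the Cauchy property. The whole sequence is kept. From `L²` to
almost everywhere: as in the Riesz–Fischer theorem, a subsequence whose successive `L²` distances
are summable converges almost everywhere. Here the sequence has to be thinned out. -/

/-- On a finite measure space, a uniformly bounded sequence converging almost everywhere is Cauchy
in `L^p` for `1 ≤ p < ∞`. -/
theorem tendsto_eLpNorm_sub_of_ae_tendsto_of_bounded {α E : Type*} [MeasurableSpace α]
    [NormedAddCommGroup E] {μ : Measure α} [IsFiniteMeasure μ] {p : ℝ≥0∞} (hp : 1 ≤ p)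
    (hp' : p ≠ ∞) {f : ℕ → α → E} (hf : ∀ k, AEStronglyMeasurable (f k) μ) {M : ℝ}
    (hM : ∀ k, ∀ᵐ x ∂μ, ‖f k x‖ ≤ M)
    (hlim : ∀ᵐ x ∂μ, ∃ l, Tendsto (fun k => f k x) atTop (𝓝 l)) :
    Tendsto (fun q : ℕ × ℕ => eLpNorm (f q.1 - f q.2) p μ) atTop (𝓝 0) := by
  obtain ⟨g, hgm, hg⟩ := exists_stronglyMeasurable_limit_of_tendsto_ae hf hlim
  have hgM : ∀ᵐ x ∂μ, ‖g x‖ ≤ M := by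
    filter_upwards [hg, ae_all_iff.2 hM] with x hx hxM
    exact le_of_tendsto' hx.norm hxM
  have hui : UnifIntegrable f p μ := by
    -- The cutoff `M + 1` lies strictly above the common bound, so the truncated tails vanish almost
    -- everywhere and the tail condition holds for every `ε`.
    refine unifIntegrable_of hp hp' hf fun ε _ => ⟨(M + 1).toNNReal, fun k => ?_⟩
    have h0 : {x | (M + 1).toNNReal ≤ ‖f k x‖₊}.indicator (f k) =ᵐ[μ] 0 := by
      filter_upwards [hM k] with x hx
      refine Set.indicator_of_notMem (fun hmem => ?_) _
      have h1 : M + 1 ≤ ‖f k x‖ := Real.toNNReal_le_iff_le_coe.1 hmem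
      linarith
    simp [eLpNorm_congr_ae h0]
  have hconv := tendsto_Lp_finite_of_tendsto_ae hp hp' hf
    (MemLp.of_bound hgm.aestronglyMeasurable M hgM) hui hg
  have hsum : Tendsto (fun q : ℕ × ℕ => eLpNorm (f q.1 - g) p μ + eLpNorm (f q.2 - g) p μ) atTop
      (𝓝 0) := by
    -- Double limits along `atTop` on `ℕ × ℕ` split into the two coordinate limits.
    rw [← prod_atTop_atTop_eq]
    simpa using (hconv.comp tendsto_fst).add (hconv.comp tendsto_snd)
  refine tendsto_of_tendsto_of_tendsto_of_le_of_le tendsto_const_nhds hsum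
    (fun _ => zero_le) fun q => ?_
  have h := eLpNorm_sub_le ((hf q.1).sub hgm.aestronglyMeasurable)
    ((hf q.2).sub hgm.aestronglyMeasurable) hp
  rwa [sub_sub_sub_cancel_right] at h

namespace DirichletResolved.Problem

variable {m : ℕ} {D : Problem m}

theorem norm_le_of_mem_ball (hb : Bornology.IsBounded D.Ω) {M : ℝ} {Z : E3 → Idx m → ℝ}
    (hZ : Z ∈ D.ball M) {X : E3} (hX : X ∈ closure D.Ω) : ‖Z X‖ ≤ M := by
  obtain ⟨hc, hs⟩ := hZ
  -- A real supremum of an unbounded family is `0` by convention, so `supNorm` controls values only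
  -- once boundedness is known; it comes from compactness of the closure.
  have hbdd : BddAbove (Set.range fun X : closure D.Ω => ‖Z X‖) := by
    have h := hb.isCompact_closure.bddAbove_image hc.norm
    rwa [Set.image_eq_range] at h
  exact (le_ciSup hbdd ⟨X, hX⟩).trans hs.le

theorem aestronglyMeasurable_of_mem_ball {M : ℝ} {Z : E3 → Idx m → ℝ} (hZ : Z ∈ D.ball M)
    (i : Idx m) :
    AEStronglyMeasurable (fun X => Z X i) (volume.restrict (closure D.Ω)) :=
  (continuousOn_pi.1 hZ.1 i).aestronglyMeasurable isClosed_closure.measurableSet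

/-- A sequence in `Ω_M` that converges almost everywhere is Cauchy in `L²`. -/
theorem tendsto_l2Dist_of_ae_tendsto (hb : Bornology.IsBounded D.Ω) {M : ℝ}
    {Z : ℕ → E3 → Idx m → ℝ} (hZ : ∀ k, Z k ∈ D.ball M)
    (hlim : ∀ᵐ X ∂(volume.restrict (closure D.Ω)),
      ∃ L : Idx m → ℝ, Tendsto (fun k => Z k X) atTop (𝓝 L)) :
    Tendsto (fun q : ℕ × ℕ => D.l2Dist (Z q.1) (Z q.2)) atTop (𝓝 0) := by
  have : IsFiniteMeasure (volume.restrict (closure D.Ω)) :=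
    isFiniteMeasure_restrict.2 hb.isCompact_closure.measure_lt_top.ne
  have hi (i : Idx m) := tendsto_eLpNorm_sub_of_ae_tendsto_of_bounded (p := 2)
    (μ := volume.restrict (closure D.Ω)) one_le_two ENNReal.ofNat_ne_top
    (f := fun k X => Z k X i) (fun k => aestronglyMeasurable_of_mem_ball (hZ k) i) (M := M)
    (fun k => by
      filter_upwards [ae_restrict_mem isClosed_closure.measurableSet] with X hX
      exact (norm_le_pi_norm (Z k X) i).trans (norm_le_of_mem_ball hb (hZ k) hX))
    (by
      filter_upwards [hlim] with X hX
      obtain ⟨L, hL⟩ := hX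
      exact ⟨L i, tendsto_pi_nhds.1 hL i⟩)
  rw [ENNReal.tendsto_nhds_zero]
  intro ε hε
  -- There are finitely many components, so one threshold serves for all of them.
  filter_upwards [eventually_all.2 fun i => ENNReal.tendsto_nhds_zero.1 (hi i) ε hε] with q hq
  exact iSup_le hq

/-- A sequence in `Ω_M` that is Cauchy in `L²` has a subsequence converging almost everywhere. -/
theorem exists_subseq_ae_tendsto_of_tendsto_l2Dist {M : ℝ}
    {W : ℕ → E3 → Idx m → ℝ} (hW : ∀ k, W k ∈ D.ball M)
    (hlim : Tendsto (fun q : ℕ × ℕ => D.l2Dist (W q.1) (W q.2)) atTop (𝓝 0)) :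
    ∃ φ : ℕ → ℕ, StrictMono φ ∧ ∀ᵐ X ∂(volume.restrict (closure D.Ω)),
      ∃ L : Idx m → ℝ, Tendsto (fun k => W (φ k) X) atTop (𝓝 L) := by
  -- Positive tolerances with sum below `1`; only the finiteness of the sum matters.
  obtain ⟨B, hB0, hB⟩ := ENNReal.exists_pos_sum_of_countable (one_ne_zero (α := ℝ≥0∞)) ℕ
  have hev (N : ℕ) : ∃ K, ∀ k ≥ K, ∀ j ≥ k, ∀ l ≥ k, D.l2Dist (W j) (W l) < B N := by
    obtain ⟨⟨a, b⟩, hab⟩ := eventually_atTop.1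
      (hlim.eventually_lt_const (ENNReal.coe_pos.2 (hB0 N)))
    exact ⟨max a b, fun k hk j hj l hl =>
      hab (j, l) ⟨(le_max_left a b).trans (hk.trans hj), (le_max_right a b).trans (hk.trans hl)⟩⟩
  -- `φ N` lies so far out that all later terms are pairwise within `B N`. As `φ` is monotone, this
  -- covers `φ j` and `φ l` for all `j, l ≥ N`, and summability of `B` then yields almost everywhere
  -- convergence of each component.
  obtain ⟨φ, hφ, hφB⟩ := extraction_forall_of_eventually' hev
  refine ⟨φ, hφ, ?_⟩
  have hi (i : Idx m) : ∀ᵐ X ∂(volume.restrict (closure D.Ω)),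
      ∃ l : ℝ, Tendsto (fun k => W (φ k) X i) atTop (𝓝 l) :=
    Lp.ae_tendsto_of_cauchy_eLpNorm (f := fun k X => W (φ k) X i) (p := 2)
      (fun k => aestronglyMeasurable_of_mem_ball (hW (φ k)) i) one_le_two
      (B := fun N => (B N : ℝ≥0∞)) (hB.trans ENNReal.one_lt_top).ne
      fun N j l hj hl => (le_iSup (fun i => eLpNorm (fun X => W (φ j) X i - W (φ l) X i) 2
        (volume.restrict (closure D.Ω))) i).trans_lt
          (hφB N (φ j) (hφ.monotone hj) (φ l) (hφ.monotone hl))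
  filter_upwards [ae_all_iff.2 hi] with X hX
  choose L hL using hX
  exact ⟨L, tendsto_pi_nhds.2 hL⟩

end DirichletResolved.Problem

theorem theorem4p3 (m : ℕ) (hm : 1 ≤ m) (α : ℝ) (hα₀ : 0 < α) (hα₁ : α ≤ 1)
    (D : DirichletResolved.Problem m) (hD : D.Standing α) (M : ℝ) (hM : 0 < M) :
    (∃ (ε : ℕ → ℝ) (Z : ℕ → DirichletResolved.E3 → DirichletResolved.Idx m → ℝ),
      (∀ k, 0 < ε k ∧ Z k ∈ D.ball M ∧ D.IsMollifiedSolution (ε k) (Z k)) ∧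
      Tendsto ε atTop (𝓝 0) ∧
      ∀ᵐ X ∂(volume.restrict (closure D.Ω)),
        ∃ L : DirichletResolved.Idx m → ℝ, Tendsto (fun k => Z k X) atTop (𝓝 L)) ↔
    (∃ (η : ℕ → ℝ) (W : ℕ → DirichletResolved.E3 → DirichletResolved.Idx m → ℝ),
      (∀ k, 0 < η k ∧ W k ∈ D.ball M ∧ D.IsMollifiedSolution (η k) (W k)) ∧
      Tendsto η atTop (𝓝 0) ∧
      Tendsto (fun p : ℕ × ℕ => D.l2Dist (W p.1) (W p.2)) atTop (𝓝 0)) := by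
  constructor
  · rintro ⟨ε, Z, hZ, hε, hlim⟩
    exact ⟨ε, Z, hZ, hε, DirichletResolved.Problem.tendsto_l2Dist_of_ae_tendsto hD.isBounded
      (fun k => (hZ k).2.1) hlim⟩
  · rintro ⟨η, W, hW, hη, hlim⟩
    obtain ⟨φ, hφ, hae⟩ :=
      DirichletResolved.Problem.exists_subseq_ae_tendsto_of_tendsto_l2Dist
        (fun k => (hW k).2.1) hlim
    -- The parameters are thinned out by the same `φ`, so each term still solves the equation with
    -- its own parameter.
    exact ⟨η ∘ φ, fun k => W (φ k), fun k => hW (φ k), hη.comp hφ.tendsto_atTop, hae⟩
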